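/- Let $\mathbb K$ be a field and let $f,g\in\mathbb K[x]$ be monic polynomials of degrees $m$ and $n$. Let $A$ and $B$ be their multisets of roots, with $|A|=m$ and $|B|=n$, in an extension field $\mathbb L$ of $\mathbb K$ over which both $f$ and $g$ split (for instance $\mathbb L=\mathbb K$, if $f$ and $g$ split over $\mathbb K$). Let $\overline A$ and $\overline B$ be the sets of distinct elements of $A$ and $B$, and set $m'=m-|\overline A|$, $n'=n-|\overline B|$. For $0\le d\le\min\{m,n\}$ if $m\neq n$, or $0\le d<m$ if $m=n$, let $\operatorname{Sres}_d(f,g)(x)\in\mathbb K[x]$ be the order $d$ subresultant: the determinant of the matrix of size $m+n-2d$ whose rows are given, from top to bottom, by the polynomials $x^{n-d-1}f,\dots,xf,f,\;x^{m-d-1}g,\dots,xg,g$, where the row of a polynomial $r$ consists of the coefficients of $x^{m+n-d-1},x^{m+n-d-2},\dots,x^{d+1}$ in $r$, followed by $r$ itself in the last column. For multisets $Y,Z$ put $\mathcal R(Y,Z)=\prod_{y\in Y,\,z\in Z}(y-z)$, with multiplicities (equal to $1$ if $Y$ or $Z$ is empty), and $\mathcal R(x,Z)=\prod_{z\in Z}(x-z)$.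 Differences of multisets subtract multiplicities; thus $A\backslash\overline A$ is $A$ with one copy of each distinct element removed, and $B\backslash B'$ is $B$ with one copy of each element of the set $B'\subset\overline B$ removed. Then for every integer $d$ such that $m'+n'\le d\le\min\{m,n\}$ if $m\ne n$, or $m'+n'\le d<m$ if $m=n$, $$\operatorname{Sres}_d(f,g)(x)=(-1)^{d(m-d)}\operatorname{SylM}_{d,0}(A,B)(x)$$ in $\mathbb L[x]$, where $$\operatorname{SylM}_{d,0}(A,B)(x)=(-1)^{m'(m-d)}\sum_{\substack{A'\subset\overline A\\|A'|=d-m'}}\ \sum_{\substack{B'\subset\overline B\\|B'|=m'}}\frac{\mathcal R(A\backslash\overline A,\overline B\backslash B')\,\mathcal R(\overline A\backslash A',B\backslash B')\,\mathcal R(x,A')\,\mathcal R(x,B')}{\mathcal R(A',\overline A\backslash A')\,\mathcal R(B',\overline B\backslash B')}.$$ -/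

import Mathlib

open Polynomial

namespace SubresultantMultipleRoots

/-- The order `d` subresultant of `f = f_m x^m + ⋯ + f_0` and `g = g_n x^n + ⋯ + g_0`, where
`m` and `n` are the degrees of `f` and `g`: the determinant of the square matrix of size
`m + n - 2d` whose rows belong to the polynomials `x^(n-d-1) f, …, x f, f` followed by
`x^(m-d-1) g, …, x g, g`. The row of a polynomial `r` is made of its coefficients in degrees
`m+n-d-1, m+n-d-2, …, d+1` and, in the last column, of `r` itself. -/
noncomputable def sres {R : Type*} [CommRing R] (d : ℕ) (f g : R[X]) : R[X] :=
  let m := f.natDegree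
  let n := g.natDegree
  let row : Fin (m + n - 2 * d) → R[X] := fun i =>
    if (i : ℕ) < n - d then X ^ (n - d - 1 - i) * f
    else X ^ (m - d - 1 - (i - (n - d))) * g
  (Matrix.of fun i j : Fin (m + n - 2 * d) =>
    if (j : ℕ) + 1 = m + n - 2 * d then row i
    else C ((row i).coeff (m + n - d - 1 - j))).det

/-- `rProd Y Z = ∏_{y ∈ Y, z ∈ Z} (y - z)`, with multiplicities; it is `1` if `Y` or `Z` is
empty. -/
def rProd {R : Type*} [CommRing R] (Y Z : Multiset R) : R :=
  (Y.map fun y => (Z.map fun z => y - z).prod).prod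

/-- `rPoly Z = ∏_{z ∈ Z} (x - z)`, that is `rProd {x} Z`, as a polynomial in `x`. -/
noncomputable def rPoly {R : Type*} [CommRing R] (Z : Multiset R) : R[X] :=
  rProd {X} (Z.map C)

/-- The number of repeated elements `|A| - |A̅|` of a multiset `A`, where `A̅` is the set of
distinct elements of `A`. -/
def excess {L : Type*} [DecidableEq L] (A : Multiset L) : ℕ :=
  Multiset.card A - A.toFinset.card

/-- The generalized Sylvester sum `SylM_{d,0}(A, B)` of multisets `A` and `B`. Here
`A.toFinset` and `B.toFinset` are the sets of distinct elements, and the multiset difference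
`A - A.toFinset.val` removes one copy of each distinct element. -/
noncomputable def sylM {L : Type*} [Field L] [DecidableEq L] (d : ℕ) (A B : Multiset L) :
    L[X] :=
  (-1) ^ (excess A * (Multiset.card A - d)) *
    ∑ A' ∈ A.toFinset.powersetCard (d - excess A),
      ∑ B' ∈ B.toFinset.powersetCard (excess A),
        C (rProd (A - A.toFinset.val) (B.toFinset \ B').val *
              rProd (A.toFinset \ A').val (B - B'.val) /
            (rProd A'.val (A.toFinset \ A').val * rProd B'.val (B.toFinset \ B').val)) *
          rPoly A'.val * rPoly B'.val

end SubresultantMultipleRoots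

/-! Write `f = u ∏ (x - a_i)` and `g = v ∏ (x - b_j)` with distinct `a_i` and distinct `b_j`, so
that `u` and `v` have degrees `m'` and `n'`. Evaluate the polynomials `x^i (x - z)` (`i < d`), `x^i
g` (`i < m - d`) and `x^i f` at all the `a_i` and `b_j`, taking as many polynomials as points, and
compute the determinant in two ways.

It is the Vandermonde determinant of the points times a coefficient determinant, which equals `±
sres d f g` at `z` (`leadingMinor_eval`, `leadingMinor_blockPoly`). On the other hand `f` vanishes
at `a_i` and `g` at `b_j`, so each row is a sum of two vectors supported in single column blocks.
Multilinear expansion gives a sum over subsets of the points (`det_pow_mul_eval_sres`); the block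
sizes leave only pairs with `|A'| = d - m'` and `|B'| = m'`, and each term is a product of three
smaller Vandermonde determinants and scalar weights (`det_blocks`).

Dividing by the full Vandermonde determinant requires that no `a_i` equals a `b_j`. In general the
roots of `g` are shifted by an indeterminate, which is then set to `0` (`sres_eq_sum`). -/

namespace SubresultantMultipleRoots

/-! ### Vandermonde factorization and the coefficient determinant -/

section

variable {R : Type*} [CommRing R]

/-- The leading principal minor of order `n` of an infinite matrix. -/
def leadingMinor (F : ℕ → ℕ → R) (n : ℕ) : R :=
  (Matrix.of fun i j : Fin n => F i j).det

theorem leadingMinor_congr {F G : ℕ → ℕ → R} {n : ℕ}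
    (h : ∀ i < n, ∀ j < n, F i j = G i j) : leadingMinor F n = leadingMinor G n := by
  unfold leadingMinor
  congr 1
  ext i j
  exact h i i.2 j j.2

theorem leadingMinor_add {F : ℕ → ℕ → R} {d k : ℕ}
    (h : ∀ i < d, ∀ j, d ≤ j → j < d + k → F i j = 0) :
    leadingMinor F (d + k) =
      leadingMinor F d * leadingMinor (fun i j => F (d + i) (d + j)) k := by
  unfold leadingMinor
  rw [← Matrix.det_submatrix_equiv_self (finSumFinEquiv : Fin d ⊕ Fin k ≃ Fin (d + k)),
    ← Matrix.det_fromBlocks_zero₁₂ _ (Matrix.of fun (i : Fin k) (j : Fin d) => F (d + i) j)]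
  congr 1
  ext i j
  rcases i with i | i <;> rcases j with j | j <;> simp
  exact h i i.2 _ (by omega) (by omega)

theorem leadingMinor_eq_one {F : ℕ → ℕ → R} {n : ℕ} (h1 : ∀ i < n, F i i = 1)
    (h0 : ∀ i j, i < j → j < n → F i j = 0) : leadingMinor F n = 1 := by
  unfold leadingMinor
  rw [Matrix.det_of_isLowerTriangular (Matrix.of fun i j : Fin n => F i j)
    (fun i j hij => h0 i j hij j.2)]
  exact Finset.prod_eq_one fun i _ => h1 i i.2

theorem leadingMinor_mul_row (w : ℕ → R) (F : ℕ → ℕ → R) (n : ℕ) :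
    leadingMinor (fun i j => w i * F i j) n =
      (∏ i ∈ Finset.range n, w i) * leadingMinor F n := by
  unfold leadingMinor
  rw [← Fin.prod_univ_eq_prod_range, ← Matrix.det_mul_column]
  rfl

theorem leadingMinor_eval_monic (y : ℕ → R) (P : ℕ → R[X]) (n : ℕ)
    (hdeg : ∀ j < n, (P j).natDegree = j) (hP : ∀ j < n, (P j).Monic) :
    leadingMinor (fun i j => (P j).eval (y i)) n = leadingMinor (fun i j => y i ^ j) n := by
  unfold leadingMinor
  exact (Matrix.det_eval_matrixOfPolynomials_eq_det_vandermonde (fun i : Fin n => y i)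
    (fun j : Fin n => P j) (fun j => hdeg j j.2) (fun j => hP j j.2)).symm

/-- Replacing the columns `x^j`, `j ≥ d`, by the monic `x^(j-d) ∏_{l<d} (x - y_l)` does not change
the determinant. These vanish at the first `d` nodes, so the matrix becomes block triangular. -/
theorem leadingMinor_pow_add (y : ℕ → R) (d k : ℕ) :
    leadingMinor (fun i j => y i ^ j) (d + k) = leadingMinor (fun i j => y i ^ j) d *
      ((∏ i ∈ Finset.range k, ∏ l ∈ Finset.range d, (y (d + i) - y l)) *
        leadingMinor (fun i j => y (d + i) ^ j) k) := by
  nontriviality R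
  have hmon : (∏ l ∈ Finset.range d, (X - C (y l))).Monic :=
    monic_prod_of_monic _ _ fun l _ => monic_X_sub_C _
  have hnat : (∏ l ∈ Finset.range d, (X - C (y l))).natDegree = d := by
    rw [natDegree_prod_of_monic _ _ fun l _ => monic_X_sub_C _]
    simp
  let P : ℕ → R[X] := fun j =>
    if j < d then X ^ j else X ^ (j - d) * ∏ l ∈ Finset.range d, (X - C (y l))
  rw [← leadingMinor_eval_monic y P, leadingMinor_add, ← leadingMinor_mul_row]
  · congr 1
    · apply leadingMinor_congr
      intro i hi j hj
      simp [P, hj]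
    · apply leadingMinor_congr
      intro i hi j hj
      simp [P, eval_prod, mul_comm]
  · intro i hi j hj _
    simp only [P, if_neg hj.not_gt, eval_mul, eval_prod]
    rw [Finset.prod_eq_zero (Finset.mem_range.2 hi) (by simp), mul_zero]
  · intro j _
    simp only [P]
    split_ifs with h
    · simp
    · rw [(monic_X_pow _).natDegree_mul hmon, hnat, natDegree_X_pow]
      omega
  · intro j _
    simp only [P]
    split_ifs with h
    · exact monic_X_pow _
    · exact (monic_X_pow _).mul hmon

theorem eval_eq_eval_add_sum {P : R[X]} {N : ℕ} (hP : P.natDegree < N) (z y : R) :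
    P.eval y = ∑ i ∈ Finset.range N,
      (if i = 0 then 1 else X ^ i - C (z ^ i)).eval y *
        (if i = 0 then P.eval z else P.coeff i) := by
  obtain ⟨N, rfl⟩ : ∃ M, N = M + 1 := ⟨N - 1, by omega⟩
  rw [Finset.sum_range_succ']
  simp only [Nat.add_eq_zero_iff, one_ne_zero, and_false, if_false, if_true, eval_one, one_mul,
    eval_sub, eval_pow, eval_X, eval_C, sub_mul, Finset.sum_sub_distrib]
  rw [eval_eq_sum_range' hP y, eval_eq_sum_range' hP z, Finset.sum_range_succ',
    Finset.sum_range_succ' _ N]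
  simp only [mul_comm, pow_zero, one_mul]
  ring

/-- In the monic basis `1, x^i - z^i` the coordinate of `P` along `1` is `P(z)` and the others are
its ordinary coefficients. This basis makes a column of values appear, like the last column of the
subresultant. -/
theorem leadingMinor_eval (y : ℕ → R) (P : ℕ → R[X]) (N : ℕ) (z : R)
    (hP : ∀ j < N, (P j).natDegree < N) :
    leadingMinor (fun i j => (P j).eval (y i)) N = leadingMinor (fun i j => y i ^ j) N *
      leadingMinor (fun j i => if i = 0 then (P j).eval z else (P j).coeff i) N := by
  nontriviality R
  rw [← leadingMinor_eval_monic y (fun i => if i = 0 then 1 else X ^ i - C (z ^ i))]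
  · unfold leadingMinor
    rw [← Matrix.det_transpose (Matrix.of fun j i : Fin N =>
      if (i : ℕ) = 0 then (P j).eval z else (P j).coeff i), ← Matrix.det_mul]
    congr 1
    ext k j
    simp only [Matrix.of_apply, Matrix.mul_apply, Matrix.transpose_apply]
    rw [eval_eq_eval_add_sum (hP j j.2) z, Finset.sum_range]
  · intro j _
    split_ifs with h
    · simp [h]
    · exact natDegree_X_pow_sub_C
  · intro j _
    split_ifs with h
    · exact monic_one
    · exact monic_X_pow_sub_C _ h

/-- The polynomials `x^i (x - z)` for `i < d`, followed by `x^i g` for `i < q`, followed by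
`x^i f`. -/
noncomputable def blockPoly (d q : ℕ) (f g : R[X]) (z : R) (j : ℕ) : R[X] :=
  if j < d then X ^ j * (X - C z)
  else if j < d + q then X ^ (j - d) * g else X ^ (j - (d + q)) * f

theorem natDegree_blockPoly_lt {d q N : ℕ} {f g : R[X]} (z : R) (hd : d < N)
    (hg : q + g.natDegree ≤ N) (hf : f.natDegree ≤ d + q)
    (j : ℕ) (hj : j < N) : (blockPoly d q f g z j).natDegree < N := by
  unfold blockPoly
  have hX : ∀ i, (X ^ i : R[X]).natDegree ≤ i := natDegree_X_pow_le
  split_ifs with h1 h2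
  · have h3 : (X - C z).natDegree ≤ 1 := natDegree_X_sub_C_le z
    have := natDegree_mul_le (p := X ^ j) (q := X - C z)
    have := hX j
    omega
  · have := natDegree_mul_le (p := X ^ (j - d)) (q := g)
    have := hX (j - d)
    omega
  · have := natDegree_mul_le (p := X ^ (j - (d + q))) (q := f)
    have := hX (j - (d + q))
    omega

theorem leadingMinor_comp_cycleRange (F : ℕ → ℕ → R) {d N : ℕ} (hd : d < N) :
    leadingMinor (fun i j => F i (if j < d then j + 1 else if j = d then 0 else j)) N =
      (-1) ^ d * leadingMinor F N := by
  unfold leadingMinor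
  have h := Matrix.det_permute' (Fin.cycleRange (⟨d, hd⟩ : Fin N))
    (Matrix.of fun i j : Fin N => F i j)
  rw [Fin.sign_cycleRange] at h
  push_cast at h
  rw [← h]
  congr 1
  ext i j
  simp only [Matrix.submatrix_apply, Matrix.of_apply, id]
  congr 1
  obtain ⟨N, rfl⟩ : ∃ M, N = M + 1 := ⟨N - 1, by omega⟩
  split_ifs with h1 h2
  · rw [Fin.coe_cycleRange_of_lt (by exact h1)]
  · rw [show j = ⟨d, hd⟩ from Fin.ext h2, Fin.cycleRange_self]; rfl
  · rw [Fin.cycleRange_of_gt (Fin.lt_def.2 (by simp; omega))]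

theorem coeff_X_pow_mul_X_sub_C (z : R) (i j : ℕ) :
    (X ^ i * (X - C z)).coeff j = (if j = i + 1 then 1 else 0) - if j = i then z else 0 := by
  simp [mul_sub, ← pow_succ, coeff_X_pow]

/-- The rows of `x^i (x - z)` have value `0` at `z` and entry `1` in column `i + 1`; once column `0`
is cycled to position `d`, they form a unitriangular block. The last `e` rows, multiples of the
monic `f`, form another one. The middle block is the subresultant matrix at `z`. -/
theorem leadingMinor_blockPoly {d q e : ℕ} {f g : R[X]} (z : R) (hf : f.Monic)
    (hdf : d ≤ f.natDegree) (hdg : d ≤ g.natDegree) (hq : q = f.natDegree - d)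
    (hlt : 2 * d < f.natDegree + g.natDegree) :
    leadingMinor (fun j i => if i = 0 then (blockPoly d q f g z j).eval z
        else (blockPoly d q f g z j).coeff i) (f.natDegree + g.natDegree - d + e) =
      (-1) ^ d * (sres d f g).eval z := by
  set m := f.natDegree with hm
  set n := g.natDegree with hn
  have hN : m + n - d + e = d + ((m + n - 2 * d) + e) := by omega
  rw [hN]
  suffices h : (-1) ^ d * leadingMinor (fun j i => if i = 0 then (blockPoly d q f g z j).eval z
        else (blockPoly d q f g z j).coeff i) (d + ((m + n - 2 * d) + e)) =
      (sres d f g).eval z by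
    rw [← h, ← mul_assoc, ← mul_pow]; simp
  have hc : ∀ t, (if d + t < d then d + t + 1 else if d + t = d then 0 else d + t) =
      if t = 0 then 0 else d + t := by
    intro t
    split_ifs <;> omega
  rw [← leadingMinor_comp_cycleRange _ (by omega), leadingMinor_add, leadingMinor_eq_one, one_mul,
    leadingMinor_add]
  · simp only [hc]
    rw [leadingMinor_eq_one (n := e), mul_one]
    · unfold sres leadingMinor
      symm
      -- The subresultant lists rows and columns by descending degree with `f` first, the block by
      -- ascending degree with `g` first. The same reversal on rows and columns costs no sign.
      rw [← Matrix.det_submatrix_equiv_self Fin.revPerm, ← coe_evalRingHom, RingHom.map_det]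
      congr 1
      ext i j
      have hi := i.2
      have hj := j.2
      have hrow : (if m + n - 2 * d - (i + 1) < n - d then
          X ^ (n - d - 1 - (m + n - 2 * d - (i + 1))) * f
          else X ^ (m - d - 1 - (m + n - 2 * d - (i + 1) - (n - d))) * g) =
          blockPoly d q f g z (d + i) := by
        unfold blockPoly
        by_cases hi' : (i : ℕ) < q
        · rw [if_neg (show ¬ m + n - 2 * d - (i + 1) < n - d by omega),
            if_neg (show ¬ d + (i : ℕ) < d by omega), if_pos (show d + (i : ℕ) < d + q by omega)]
          congr 2
          omega
        · rw [if_pos (show m + n - 2 * d - (i + 1) < n - d by omega),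
            if_neg (show ¬ d + (i : ℕ) < d by omega),
            if_neg (show ¬ d + (i : ℕ) < d + q by omega)]
          congr 2
          omega
      simp only [Matrix.submatrix_apply, Matrix.of_apply, Fin.revPerm_apply, Fin.val_rev,
        RingHom.mapMatrix_apply, Matrix.map_apply, coe_evalRingHom, ← hm, ← hn, hrow]
      by_cases hj0 : (j : ℕ) = 0
      · rw [if_pos (by omega), hj0]
        simp
      · rw [if_neg (by omega), eval_C,
          show m + n - d - 1 - (m + n - 2 * d - (j + 1)) = d + j by omega, if_neg hj0,
          if_neg (by omega)]
    · intro i hi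
      rw [if_neg (show ¬ m + n - 2 * d + i = 0 by omega),
        if_neg (show ¬ d + (m + n - 2 * d + i) = 0 by omega), blockPoly, if_neg (by omega),
        if_neg (by omega), coeff_X_pow_mul', if_pos (by omega),
        show d + (m + n - 2 * d + i) - (d + (m + n - 2 * d + i) - (d + q)) = m by omega]
      exact hf
    · intro i j hij hj
      rw [if_neg (show ¬ m + n - 2 * d + j = 0 by omega),
        if_neg (show ¬ d + (m + n - 2 * d + j) = 0 by omega)]
      -- From row `m + n - d` on, the degree of a row's polynomial is at most the row index, so the
      -- bound is taken one above that index.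
      refine coeff_eq_zero_of_natDegree_lt (lt_of_lt_of_le (natDegree_blockPoly_lt
        (N := d + (m + n - 2 * d + i) + 1) z ?_ ?_ ?_ _ ?_) ?_) <;> omega
  · intro i hi j hj hj'
    rw [hc, if_neg (show ¬ j = 0 by omega), if_neg (show ¬ d + j = 0 by omega)]
    refine coeff_eq_zero_of_natDegree_lt (lt_of_lt_of_le
      (natDegree_blockPoly_lt (N := m + n - d) z ?_ ?_ ?_ _ ?_) ?_) <;> omega
  · intro i hi
    simp only [blockPoly, if_pos hi, coeff_X_pow_mul_X_sub_C]
    simp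
  · intro i j hij hj
    simp only [blockPoly, if_pos hj, if_pos (hij.trans hj), coeff_X_pow_mul_X_sub_C]
    rw [if_neg (by omega), if_neg (by omega), if_neg (by omega), sub_zero]
  · intro i hi j hj hj'
    simp only [blockPoly, if_pos hi, if_neg hj.not_gt, coeff_X_pow_mul_X_sub_C]
    split_ifs <;> first | omega | simp

end

/-! ### Determinants with three column blocks -/

section

variable {R : Type*} [CommRing R] {ι : Type*} [Fintype ι]

/-- The block of `j` when `ℕ` is cut into `[0, d)`, `[d, d + q)` and `[d + q, ∞)`. -/
def colBlock (d q j : ℕ) : Fin 3 := if j < d then 0 else if j < d + q then 1 else 2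

/-- The position of `j` inside its block `colBlock d q j`. -/
def colOffset (d q j : ℕ) : ℕ :=
  if j < d then j else if j < d + q then j - d else j - (d + q)

theorem card_filter_colBlock (d q p : ℕ) (b : Fin 3) :
    (Finset.univ.filter fun i : Fin (d + (q + p)) => colBlock d q i = b).card = ![d, q, p] b := by
  have key : (Finset.univ.filter fun i : Fin (d + (q + p)) => colBlock d q i = b).map
      Fin.valEmbedding = Finset.Ico (![0, d, d + q] b) (![d, d + q, d + (q + p)] b) := by
    ext j
    simp only [Finset.mem_map, Finset.mem_filter, Finset.mem_univ, true_and,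
      Fin.valEmbedding_apply, Finset.mem_Ico]
    constructor
    · rintro ⟨i, rfl, rfl⟩
      have := i.2
      unfold colBlock
      split_ifs <;> simp <;> omega
    · intro h
      refine ⟨⟨j, ?_⟩, ?_, rfl⟩
      · fin_cases b <;> simp at h <;> omega
      · unfold colBlock
        fin_cases b <;> simp at h
        · simp [h]
        · simp [h.1, h.2]
        · have : ¬ j < d := by omega
          simp [h.1, this]
  rw [← Finset.card_map Fin.valEmbedding, key, Nat.card_Ico]
  fin_cases b <;> simp
  omega

theorem exists_equiv_colBlock {d q p : ℕ} (τ : ι → Fin 3)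
    (h : ∀ b, (Finset.univ.filter fun k => τ k = b).card = ![d, q, p] b) :
    ∃ ε : ι ≃ Fin (d + (q + p)), ∀ k, colBlock d q (ε k) = τ k := by
  have e : ∀ b, Nonempty
      ({k // τ k = b} ≃ {i : Fin (d + (q + p)) // colBlock d q i = b}) := by
    intro b
    apply Fintype.card_eq.1
    rw [Fintype.card_subtype, Fintype.card_subtype, h, card_filter_colBlock]
  exact ⟨Equiv.ofFiberEquiv fun b => (e b).some, fun k =>
    Equiv.ofFiberEquiv_map (g := fun i : Fin (d + (q + p)) => colBlock d q i) _ k⟩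

theorem card_filter_of_equiv_colBlock {d q p : ℕ} {τ : ι → Fin 3}
    {ε : ι ≃ Fin (d + (q + p))} (h : ∀ k, colBlock d q (ε k) = τ k) (b : Fin 3) :
    (Finset.univ.filter fun k => τ k = b).card = ![d, q, p] b := by
  rw [← card_filter_colBlock]
  refine Finset.card_bij (fun k _ => ε k) ?_ (fun _ _ _ _ h => ε.injective h) ?_
  · intro k hk
    simpa [h] using hk
  · intro i hi
    exact ⟨ε.symm i, by simpa [← h] using hi, by simp⟩

/-- A nonzero term of the Leibniz expansion is a permutation sending each row into its own block.
Hence mismatched block sizes force the determinant to vanish. -/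
theorem exists_equiv_of_det_ne_zero [DecidableEq ι] {d q p : ℕ} (γ : ι ≃ Fin (d + (q + p))) (τ : ι → Fin 3)
    (F : ι → ℕ → R)
    (h : (Matrix.of fun k j : ι => if colBlock d q (γ j) = τ k then F k (γ j) else 0).det ≠ 0) :
    ∃ ε : ι ≃ Fin (d + (q + p)), ∀ k, colBlock d q (ε k) = τ k := by
  rw [Matrix.det_apply] at h
  obtain ⟨σ, -, hσ⟩ := Finset.exists_ne_zero_of_sum_ne_zero h
  refine ⟨σ.symm.trans γ, fun k => ?_⟩
  by_contra hk
  apply hσ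
  rw [Finset.prod_eq_zero (Finset.mem_univ (σ.symm k)), smul_zero]
  simpa using fun h => absurd h hk

theorem det_of_equiv [DecidableEq ι] {N : ℕ} (F : ι → ℕ → R) (γ ε : ι ≃ Fin N) (x : ℕ → ι)
    (hx : ∀ i : Fin N, x i = ε.symm i) :
    (Matrix.of fun k j : ι => F k (γ j)).det =
      (Equiv.Perm.sign (γ.symm.trans ε) : ℤ) * leadingMinor (fun i j => F (x i) j) N := by
  unfold leadingMinor
  rw [← Matrix.det_permute, ← Matrix.det_submatrix_equiv_self γ]
  congr 1
  ext k j
  simp [hx]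

theorem prod_range_eq_prod_filter_colBlock {N : ℕ} {κ : ι → Prop} [DecidablePred κ]
    (ε : ι ≃ Fin N) (x : ℕ → ι) (hx : ∀ i : Fin N, x i = ε.symm i) (φ : ι → R) (a l : ℕ)
    (hal : a + l ≤ N) (h : ∀ k, κ k ↔ a ≤ (ε k : ℕ) ∧ (ε k : ℕ) < a + l) :
    ∏ i ∈ Finset.range l, φ (x (a + i)) = ∏ k ∈ Finset.univ.filter κ, φ k := by
  have hx' : ∀ i (hi : i < l), x (a + i) = ε.symm ⟨a + i, by omega⟩ :=
    fun i hi => hx ⟨a + i, by omega⟩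
  refine Finset.prod_bij (fun i _ => x (a + i)) ?_ ?_ ?_ fun _ _ => rfl
  · intro i hi
    rw [Finset.mem_range] at hi
    simp [h, hx' i hi, hi]
  · intro i hi j hj hij
    rw [Finset.mem_range] at hi hj
    simpa [hx' i hi, hx' j hj] using hij
  · intro k hk
    obtain ⟨h1, h2⟩ := (h k).1 (by simpa using hk)
    refine ⟨(ε k : ℕ) - a, Finset.mem_range.2 (by omega), ?_⟩
    rw [hx' _ (by omega), Equiv.symm_apply_eq]
    ext
    simp [h1]

/-- Grouping the rows by block makes the first matrix block diagonal, with weighted Vandermonde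
blocks, while two uses of `leadingMinor_pow_add` split the full Vandermonde determinant. The common
`Y` is the sign of the regrouping times the three block determinants; it expresses their ratio
without division. -/
theorem det_blocks [DecidableEq ι] {d q p : ℕ} (γ : ι ≃ Fin (d + (q + p))) (τ : ι → Fin 3) (ω c : ι → R)
    (hN : 0 < d + (q + p))
    (hτ : ∀ b, (Finset.univ.filter fun k => τ k = b).card = ![d, q, p] b) :
    ∃ Y : R,
      (Matrix.of fun k j : ι => if colBlock d q (γ j) = τ k then ω k * c k ^ colOffset d q (γ j)
        else 0).det = Y * ∏ k, ω k ∧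
      (Matrix.of fun k j : ι => c k ^ (γ j : ℕ)).det = Y *
        ((∏ k with τ k = 1, ∏ l with τ l = 0, (c k - c l)) *
          ((∏ k with τ k = 2, ∏ l with τ l = 0, (c k - c l)) *
            ∏ k with τ k = 2, ∏ l with τ l = 1, (c k - c l))) := by
  obtain ⟨ε, hε⟩ := exists_equiv_colBlock τ hτ
  -- The enumeration is extended to `ℕ` to fit `leadingMinor`; its values past the end are
  -- arbitrary.
  obtain ⟨x, hx⟩ : ∃ x : ℕ → ι, ∀ i : Fin (d + (q + p)), x i = ε.symm i :=
    ⟨fun i => if h : i < d + (q + p) then ε.symm ⟨i, h⟩ else ε.symm ⟨0, hN⟩,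
      fun i => by simp [i.2]⟩
  have hτx : ∀ i < d + (q + p), τ (x i) = colBlock d q i := by
    intro i hi
    rw [hx ⟨i, hi⟩, ← hε]
    simp
  have h0 : ∀ k, τ k = 0 ↔ 0 ≤ (ε k : ℕ) ∧ (ε k : ℕ) < 0 + d := by
    intro k
    rw [← hε]
    unfold colBlock
    split_ifs <;> simp <;> omega
  have h1 : ∀ k, τ k = 1 ↔ d ≤ (ε k : ℕ) ∧ (ε k : ℕ) < d + q := by
    intro k
    rw [← hε]
    unfold colBlock
    split_ifs <;> simp <;> omega
  have h2 : ∀ k, τ k = 2 ↔ d + q ≤ (ε k : ℕ) ∧ (ε k : ℕ) < d + q + p := by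
    intro k
    have := (ε k).2
    rw [← hε]
    unfold colBlock
    split_ifs <;> simp <;> omega
  have p0 : ∀ φ : ι → R, ∏ i ∈ Finset.range d, φ (x i) = ∏ k with τ k = 0, φ k := fun φ => by
    rw [← prod_range_eq_prod_filter_colBlock ε x hx φ 0 d (by omega) h0]; simp
  have p1 : ∀ φ : ι → R, ∏ i ∈ Finset.range q, φ (x (d + i)) = ∏ k with τ k = 1, φ k :=
    fun φ => prod_range_eq_prod_filter_colBlock ε x hx φ d q (by omega) h1
  have p2 : ∀ φ : ι → R, ∏ i ∈ Finset.range p, φ (x (d + q + i)) = ∏ k with τ k = 2, φ k :=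
    fun φ => prod_range_eq_prod_filter_colBlock ε x hx φ (d + q) p (by omega) h2
  have pN : ∏ i ∈ Finset.range (d + (q + p)), ω (x i) = ∏ k, ω k := by
    have := prod_range_eq_prod_filter_colBlock (κ := fun _ => True) ε x hx ω 0 (d + (q + p))
      (by omega) (fun k => by simp)
    simpa using this
  refine ⟨(Equiv.Perm.sign (γ.symm.trans ε) : ℤ) *
    (leadingMinor (fun i j => c (x i) ^ j) d * (leadingMinor (fun i j => c (x (d + i)) ^ j) q *
      leadingMinor (fun i j => c (x (d + q + i)) ^ j) p)), ?_, ?_⟩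
  · rw [det_of_equiv (fun k j => if colBlock d q j = τ k then ω k * c k ^ colOffset d q j else 0)
      γ ε x hx, leadingMinor_congr (G := fun i j => ω (x i) *
        if colBlock d q j = colBlock d q i then c (x i) ^ colOffset d q j else 0),
      leadingMinor_mul_row (fun i => ω (x i)), pN, leadingMinor_add, leadingMinor_add]
    · have a0 : leadingMinor (fun i j => if colBlock d q j = colBlock d q i then
          c (x i) ^ colOffset d q j else 0) d = leadingMinor (fun i j => c (x i) ^ j) d := by
        apply leadingMinor_congr
        intro i hi j hj
        simp [colBlock, colOffset, hi, hj]
      have a1 : leadingMinor (fun i j => if colBlock d q (d + j) = colBlock d q (d + i) then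
          c (x (d + i)) ^ colOffset d q (d + j) else 0) q =
          leadingMinor (fun i j => c (x (d + i)) ^ j) q := by
        apply leadingMinor_congr
        intro i hi j hj
        simp [colBlock, colOffset, hi, hj]
      have a2 : leadingMinor (fun i j => if colBlock d q (d + (q + j)) =
          colBlock d q (d + (q + i)) then c (x (d + (q + i))) ^ colOffset d q (d + (q + j))
          else 0) p = leadingMinor (fun i j => c (x (d + q + i)) ^ j) p := by
        apply leadingMinor_congr
        intro i hi j hj
        have h : ∀ t, ¬ d + q + t < d := by omega
        simp [colBlock, colOffset, ← add_assoc, h]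
      rw [a0, a1, a2]
      ring
    · intro i hi j hj _
      rw [if_neg]
      simp [colBlock, hi, hj.not_gt]
    · intro i hi j hj _
      rw [if_neg]
      unfold colBlock
      split_ifs <;> omega
    · intro i hi j hj
      simp only [hτx i hi]
      split_ifs <;> simp
  · rw [det_of_equiv (fun k j => c k ^ j) γ ε x hx, leadingMinor_pow_add (fun i => c (x i)),
      leadingMinor_pow_add (fun i => c (x (d + i))), Finset.prod_range_add]
    simp only [← add_assoc]
    have r1 := p1 fun k => ∏ l ∈ Finset.range d, (c k - c (x l))
    have r2 := p2 fun k => ∏ l ∈ Finset.range d, (c k - c (x l))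
    have r3 := p2 fun k => ∏ l ∈ Finset.range q, (c k - c (x (d + l)))
    rw [r1, r2, r3]
    simp only [fun k => p0 fun l => c k - c l, fun k => p1 fun l => c k - c l]
    ring

end

/-! ### Multilinear expansion over subsets of the roots -/

section

variable {R : Type*} [CommRing R]

theorem prod_prod_sub_comm {κ μ : Type*} (S : Finset κ) (T : Finset μ) (x : κ → R) (y : μ → R) :
    ∏ i ∈ S, ∏ j ∈ T, (x i - y j) =
      (-1) ^ (S.card * T.card) * ∏ j ∈ T, ∏ i ∈ S, (y j - x i) := by
  have h : ∀ j i, x i - y j = -1 * (y j - x i) := fun j i => by ring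
  rw [Finset.prod_comm]
  simp only [h, Finset.prod_mul_distrib, Finset.prod_const, ← pow_mul]

variable {α β : Type*} [Fintype α] [Fintype β] [DecidableEq α] [DecidableEq β]

/-- The column block in which the row of the point `k` is supported: the block `0` if `k ∈ S`,
and otherwise the block `1` or `2`, according to the summand of `k`. -/
def rowBlock (S : Finset (α ⊕ β)) (k : α ⊕ β) : Fin 3 :=
  if k ∈ S then 0 else Sum.elim (fun _ => 1) (fun _ => 2) k

theorem filter_rowBlock_zero (S : Finset α) (T : Finset β) :
    (Finset.univ.filter fun k => rowBlock (S.disjSum T) k = 0) = S.disjSum T := by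
  ext k
  rcases k with k | k <;> simp [rowBlock]

theorem filter_rowBlock_one (S : Finset α) (T : Finset β) :
    (Finset.univ.filter fun k => rowBlock (S.disjSum T) k = 1) = Sᶜ.disjSum ∅ := by
  ext k
  rw [Finset.mem_filter]
  rcases k with k | k <;> simp [rowBlock]
  split_ifs <;> simp

theorem filter_rowBlock_two (S : Finset α) (T : Finset β) :
    (Finset.univ.filter fun k => rowBlock (S.disjSum T) k = 2) = Finset.disjSum ∅ Tᶜ := by
  ext k
  rw [Finset.mem_filter]
  rcases k with k | k <;> simp [rowBlock]
  split_ifs <;> simp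

/-- The factor of the row of the point `k` in the block `rowBlock S k`. -/
noncomputable def rowWeight (a : α → R) (b : β → R) (f g : R[X]) (z : R) (S : Finset (α ⊕ β))
    (k : α ⊕ β) : R :=
  if k ∈ S then Sum.elim a b k - z
  else Sum.elim (fun i => g.eval (a i)) (fun j => f.eval (b j)) k

theorem prod_rowWeight (a : α → R) (b : β → R) (f g : R[X]) (z : R) (S : Finset α)
    (T : Finset β) :
    ∏ k, rowWeight a b f g z (S.disjSum T) k =
      ((∏ i ∈ S, (a i - z)) * ∏ j ∈ T, (b j - z)) *
        ((∏ i ∈ Sᶜ, g.eval (a i)) * ∏ j ∈ Tᶜ, f.eval (b j)) := by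
  rw [Fintype.prod_sum_type, ← Finset.prod_mul_prod_compl S, ← Finset.prod_mul_prod_compl T,
    mul_mul_mul_comm]
  congr 2 <;> refine Finset.prod_congr rfl fun i hi => ?_ <;> simp_all [rowWeight]

/-- Both sides equal the determinant of all `blockPoly` values. In the expansion, `S` is the set of
points whose row contributes its part in block `0`. -/
theorem det_pow_mul_eval_sres {d q p e : ℕ} (γ : α ⊕ β ≃ Fin (d + (q + p))) (a : α → R)
    (b : β → R) {f g : R[X]} (z : R) (hf : f.Monic) (hfa : ∀ i, f.eval (a i) = 0)
    (hgb : ∀ j, g.eval (b j) = 0) (hdf : d ≤ f.natDegree) (hdg : d ≤ g.natDegree)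
    (hq : q = f.natDegree - d) (hlt : 2 * d < f.natDegree + g.natDegree)
    (hN : d + (q + p) = f.natDegree + g.natDegree - d + e) :
    (Matrix.of fun k j : α ⊕ β => Sum.elim a b k ^ (γ j : ℕ)).det *
        ((-1) ^ d * (sres d f g).eval z) =
      ∑ S : Finset (α ⊕ β), (Matrix.of fun k j : α ⊕ β =>
        if colBlock d q (γ j) = rowBlock S k then
          rowWeight a b f g z S k * Sum.elim a b k ^ colOffset d q (γ j) else 0).det := by
  obtain ⟨x, hx⟩ : ∃ x : ℕ → α ⊕ β, ∀ i : Fin (d + (q + p)), x i = γ.symm i :=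
    ⟨fun i => if h : i < d + (q + p) then γ.symm ⟨i, h⟩ else γ.symm ⟨0, by omega⟩,
      fun i => by simp [i.2]⟩
  have h1 : (Matrix.of fun k j : α ⊕ β => Sum.elim a b k ^ (γ j : ℕ)).det *
        ((-1) ^ d * (sres d f g).eval z) =
      (Matrix.of fun k j : α ⊕ β => (blockPoly d q f g z (γ j)).eval (Sum.elim a b k)).det := by
    rw [det_of_equiv (fun k j => Sum.elim a b k ^ j) γ γ x hx,
      det_of_equiv (fun k j => (blockPoly d q f g z j).eval (Sum.elim a b k)) γ γ x hx,
      leadingMinor_eval (fun i => Sum.elim a b (x i)) _ _ z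
        (natDegree_blockPoly_lt z (by omega) (by omega) (by omega)),
      (congrArg (leadingMinor _) hN).trans (leadingMinor_blockPoly z hf hdf hdg hq hlt),
      mul_assoc]
  rw [h1]
  have h2 := Matrix.detRowAlternating.toMultilinearMap.map_add_univ
    (fun k j : α ⊕ β => if colBlock d q (γ j) = 0 then
      (Sum.elim a b k - z) * Sum.elim a b k ^ colOffset d q (γ j) else 0)
    (fun k j : α ⊕ β => if colBlock d q (γ j) = Sum.elim (fun _ => 1) (fun _ => 2) k then
      Sum.elim (fun i => g.eval (a i)) (fun j => f.eval (b j)) k *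
        Sum.elim a b k ^ colOffset d q (γ j) else 0)
  refine Eq.trans ?_ (h2.trans (Finset.sum_congr rfl fun S _ => ?_))
  · change Matrix.det _ = Matrix.det _
    congr 1
    ext k j
    simp only [Matrix.of_apply, Pi.add_apply, blockPoly, colBlock, colOffset]
    by_cases h3 : (γ j : ℕ) < d
    · rcases k with k | k <;> simp [h3, mul_comm]
    · by_cases h4 : (γ j : ℕ) < d + q <;> rcases k with k | k <;>
        simp [h3, h4, hfa, hgb, mul_comm]
  · change Matrix.det _ = Matrix.det _
    congr 1
    ext k j
    by_cases hk : k ∈ S <;> simp [Finset.piecewise, hk, rowBlock, rowWeight]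

/-- The full Vandermonde determinant is nonzero because all points are distinct, so it can be
cancelled. The function `w` supplies the inverses of the denominators, so that the identity applies
over polynomial rings. -/
theorem eval_sres_eq_sum [IsDomain R] {d : ℕ} (a : α → R) (b : β → R) (ha : a.Injective)
    (hb : b.Injective) (hab : ∀ i j, a i ≠ b j) {f g u v : R[X]} (z : R) (hu : u.Monic)
    (hv : v.Monic) (hf : f = u * ∏ i, (X - C (a i))) (hg : g = v * ∏ j, (X - C (b j)))
    (hd : u.natDegree + v.natDegree ≤ d) (hdf : d ≤ f.natDegree) (hdg : d ≤ g.natDegree)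
    (hlt : 2 * d < f.natDegree + g.natDegree) (w : Finset α → Finset β → R)
    (hw : ∀ S T, w S T * ((∏ i ∈ S, ∏ i' ∈ Sᶜ, (a i - a i')) *
      ∏ j ∈ T, ∏ j' ∈ Tᶜ, (b j - b j')) = 1) :
    (sres d f g).eval z =
      (-1) ^ ((f.natDegree - d) * (d - u.natDegree) +
          (Fintype.card β - u.natDegree) * u.natDegree) *
        ∑ S ∈ Finset.univ.powersetCard (d - u.natDegree),
          ∑ T ∈ Finset.univ.powersetCard u.natDegree, w S T *
            ((∏ j ∈ Tᶜ, u.eval (b j)) *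
              (∏ i ∈ Sᶜ, (v.eval (a i) * ∏ j ∈ Tᶜ, (a i - b j))) *
              ((∏ i ∈ S, (z - a i)) * ∏ j ∈ T, (z - b j))) := by
  have hma : (∏ i, (X - C (a i))).Monic := monic_prod_of_monic _ _ fun l _ => monic_X_sub_C _
  have hmb : (∏ j, (X - C (b j))).Monic := monic_prod_of_monic _ _ fun l _ => monic_X_sub_C _
  have hfm : f.Monic := hf ▸ hu.mul hma
  have hm : f.natDegree = u.natDegree + Fintype.card α := by
    rw [hf, hu.natDegree_mul hma, natDegree_prod_of_monic _ _ fun l _ => monic_X_sub_C _]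
    simp
  have hn : g.natDegree = v.natDegree + Fintype.card β := by
    rw [hg, hv.natDegree_mul hmb, natDegree_prod_of_monic _ _ fun l _ => monic_X_sub_C _]
    simp
  obtain ⟨q, hq⟩ : ∃ q, q = f.natDegree - d := ⟨_, rfl⟩
  obtain ⟨p, hp⟩ : ∃ p, p = Fintype.card β - u.natDegree := ⟨_, rfl⟩
  have hcard : Fintype.card (α ⊕ β) = d + (q + p) := by
    rw [Fintype.card_sum]
    omega
  let γ : α ⊕ β ≃ Fin (d + (q + p)) := Fintype.equivFinOfCardEq hcard
  have hV : (Matrix.of fun k j : α ⊕ β => Sum.elim a b k ^ (γ j : ℕ)).det ≠ 0 := by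
    have hinj : (Sum.elim a b).Injective := ha.sumElim hb hab
    have := Matrix.det_vandermonde_ne_zero_iff.2 (hinj.comp γ.symm.injective)
    rw [← Matrix.det_submatrix_equiv_self γ] at this
    convert this using 2
    ext k j
    simp [Matrix.vandermonde_apply]
  -- There are `m + n - m' - n'` points, which is `e` more than `m + n - d`; here `m' + n' ≤ d` is
  -- essential.
  have key := det_pow_mul_eval_sres (e := d - (u.natDegree + v.natDegree)) γ a b z hfm
    (fun i => by
      rw [hf, eval_mul, eval_prod, Finset.prod_eq_zero (Finset.mem_univ i) (by simp), mul_zero])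
    (fun j => by
      rw [hg, eval_mul, eval_prod, Finset.prod_eq_zero (Finset.mem_univ j) (by simp), mul_zero])
    hdf hdg hq hlt (by omega)
  refine mul_left_cancel₀ hV (mul_left_cancel₀ (pow_ne_zero d (neg_ne_zero.2 one_ne_zero)) ?_)
  rw [mul_left_comm, key, ← hq, ← hp,
    Fintype.sum_equiv Finset.sumEquiv.toEquiv _ (fun P => (Matrix.of fun k j : α ⊕ β =>
        if colBlock d q (γ j) = rowBlock (P.1.disjSum P.2) k then
          rowWeight a b f g z (P.1.disjSum P.2) k * Sum.elim a b k ^ colOffset d q (γ j)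
        else 0).det) fun S => by
      have : S = (Finset.sumEquiv S).1.disjSum (Finset.sumEquiv S).2 :=
        (Finset.sumEquiv.symm_apply_apply S).symm
      conv_lhs => rw [this]
      rfl, Fintype.sum_prod_type]
  simp only [Finset.mul_sum]
  have hcards : ∀ (S : Finset α) (T : Finset β),
      (∀ c, (Finset.univ.filter fun k => rowBlock (S.disjSum T) k = c).card = ![d, q, p] c) ↔
        S.card = d - u.natDegree ∧ T.card = u.natDegree := by
    intro S T
    have hS := S.card_le_univ
    have hT := T.card_le_univ
    rw [Fin.forall_fin_succ, Fin.forall_fin_two, Fin.succ_zero_eq_one, Fin.succ_one_eq_two,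
      filter_rowBlock_zero, filter_rowBlock_one, filter_rowBlock_two]
    simp only [Finset.card_disjSum, Finset.card_compl, Finset.card_empty, Matrix.cons_val]
    omega
  have hzero : ∀ (S : Finset α) (T : Finset β), ¬ (S.card = d - u.natDegree ∧
      T.card = u.natDegree) → (Matrix.of fun k j : α ⊕ β =>
        if colBlock d q (γ j) = rowBlock (S.disjSum T) k then
          rowWeight a b f g z (S.disjSum T) k * Sum.elim a b k ^ colOffset d q (γ j)
        else 0).det = 0 := by
    intro S T h
    by_contra h0
    obtain ⟨ε, hε⟩ := exists_equiv_of_det_ne_zero γ _ (fun k j =>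
      rowWeight a b f g z (S.disjSum T) k * Sum.elim a b k ^ colOffset d q j) h0
    exact h ((hcards S T).1 (card_filter_of_equiv_colBlock hε))
  symm
  apply Finset.sum_subset_zero_on_sdiff (Finset.subset_univ _)
  · intro S hS
    refine Finset.sum_eq_zero fun T _ => hzero S T fun h => ?_
    simp [Finset.mem_powersetCard, h.1] at hS
  intro S hS
  apply Finset.sum_subset_zero_on_sdiff (Finset.subset_univ _)
  · intro T hT
    refine hzero S T fun h => ?_
    simp [Finset.mem_powersetCard, h.2] at hT
  intro T hT
  rw [Finset.mem_powersetCard] at hS hT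
  obtain ⟨Y, hY1, hY2⟩ := det_blocks γ (rowBlock (S.disjSum T))
    (rowWeight a b f g z (S.disjSum T)) (Sum.elim a b) (by omega) ((hcards S T).2 ⟨hS.2, hT.2⟩)
  rw [hY1, hY2, prod_rowWeight, filter_rowBlock_zero, filter_rowBlock_one, filter_rowBlock_two]
  simp only [Finset.prod_disjSum, Finset.prod_empty, one_mul, mul_one, Sum.elim_inl,
    Sum.elim_inr, Finset.prod_mul_distrib]
  have hfb : ∀ j, f.eval (b j) = u.eval (b j) * ((∏ i ∈ S, (b j - a i)) * ∏ i ∈ Sᶜ, (b j - a i)) :=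
    fun j => by simp [hf, eval_prod, Finset.prod_mul_prod_compl]
  have hga : ∀ i, g.eval (a i) = v.eval (a i) * ((∏ j ∈ T, (a i - b j)) * ∏ j ∈ Tᶜ, (a i - b j)) :=
    fun i => by simp [hg, eval_prod, Finset.prod_mul_prod_compl]
  simp only [hfb, hga, Finset.prod_mul_distrib]
  have hSc : Sᶜ.card = q := by rw [Finset.card_compl]; omega
  have hTc : Tᶜ.card = p := by rw [Finset.card_compl]; omega
  have hzS : ∏ i ∈ S, (z - a i) = (-1) ^ S.card * ∏ i ∈ S, (a i - z) := by
    simpa using prod_prod_sub_comm {()} S (fun _ => z) a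
  have hzT : ∏ j ∈ T, (z - b j) = (-1) ^ T.card * ∏ j ∈ T, (b j - z) := by
    simpa using prod_prod_sub_comm {()} T (fun _ => z) b
  have hsq : ∀ k : ℕ, ((-1 : R) ^ k) * (-1) ^ k = 1 := fun k => by
    rw [← mul_pow, neg_one_mul, neg_neg, one_pow]
  have hd' : (-1 : R) ^ d = (-1) ^ S.card * (-1) ^ T.card := by
    rw [← pow_add, hS.2, hT.2]
    congr 1
    omega
  -- The mixed products over `Sᶜ × T`, `Tᶜ × S` and `Tᶜ × Sᶜ` occur both in the Vandermonde
  -- determinant and in the weights. After reorienting the other differences, every sign occurs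
  -- twice and cancels.
  rw [prod_prod_sub_comm Sᶜ S a a, prod_prod_sub_comm Tᶜ T b b, hSc, hTc, hzS, hzT, hd', hS.2,
    hT.2, pow_add]
  have hw' := hw S T
  have s1 := hsq (q * (d - u.natDegree))
  have s2 := hsq (p * u.natDegree)
  have s3 := hsq (d - u.natDegree)
  have s4 := hsq u.natDegree
  generalize (-1 : R) ^ (q * (d - u.natDegree)) = σ₁ at *
  generalize (-1 : R) ^ (p * u.natDegree) = σ₂ at *
  generalize (-1 : R) ^ (d - u.natDegree) = σ₃ at *
  generalize (-1 : R) ^ u.natDegree = σ₄ at *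
  generalize (∏ i ∈ S, ∏ i' ∈ Sᶜ, (a i - a i')) = ρ₁ at *
  generalize (∏ i ∈ T, ∏ i' ∈ Tᶜ, (b i - b i')) = ρ₂ at *
  generalize w S T = c at *
  generalize hY : Y * (((∏ i ∈ S, (a i - z)) * ∏ j ∈ T, (b j - z)) *
        ((∏ x ∈ Sᶜ, eval (a x) v) * ((∏ x ∈ Sᶜ, ∏ x_1 ∈ T, (a x - b x_1)) *
          ∏ x ∈ Sᶜ, ∏ j ∈ Tᶜ, (a x - b j)) *
          ((∏ j ∈ Tᶜ, eval (b j) u) * ((∏ x ∈ Tᶜ, ∏ x_1 ∈ S, (b x - a x_1)) *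
            ∏ x ∈ Tᶜ, ∏ x_1 ∈ Sᶜ, (b x - a x_1))))) = Z
  calc _ = Z * (σ₁ * σ₁) * (σ₂ * σ₂) * (σ₃ * σ₃) * (σ₄ * σ₄) * (c * (ρ₁ * ρ₂)) := by
        rw [← hY]; ring
    _ = Z := by rw [s1, s2, s3, s4, hw']; ring

end

/-! ### Common roots, by specialization -/

theorem map_sres {R S : Type*} [CommRing R] [CommRing S] (φ : R →+* S) (d : ℕ) (f g : R[X])
    (hf : (f.map φ).natDegree = f.natDegree) (hg : (g.map φ).natDegree = g.natDegree) :
    (sres d f g).map φ = sres d (f.map φ) (g.map φ) := by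
  unfold sres
  rw [hf, hg, ← coe_mapRingHom, RingHom.map_det]
  congr 1
  ext1 i j
  simp only [RingHom.mapMatrix_apply, Matrix.map_apply, Matrix.of_apply, coe_mapRingHom]
  have h : ∀ k (P : R[X]), X ^ k * P.map φ = (X ^ k * P).map φ := by simp
  split_ifs <;> simp only [map_C, h, coeff_map]

/-- Over `L[x][t]` the points `a_i` and `b_j + t` never coincide, as their coefficients of `t`
differ. The formula holds there with `z = x`, and setting `t = 0` gives the claim. -/
theorem sres_eq_sum {L α β : Type*} [Field L] [Fintype α] [Fintype β] [DecidableEq α]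
    [DecidableEq β] {d : ℕ} (a : α → L) (b : β → L) (ha : a.Injective) (hb : b.Injective)
    {f g u v : L[X]} (hu : u.Monic) (hv : v.Monic) (hf : f = u * ∏ i, (X - C (a i)))
    (hg : g = v * ∏ j, (X - C (b j))) (hd : u.natDegree + v.natDegree ≤ d)
    (hdf : d ≤ f.natDegree) (hdg : d ≤ g.natDegree)
    (hlt : 2 * d < f.natDegree + g.natDegree) :
    sres d f g =
      (-1) ^ ((f.natDegree - d) * (d - u.natDegree) +
          (Fintype.card β - u.natDegree) * u.natDegree) *
        ∑ S ∈ Finset.univ.powersetCard (d - u.natDegree),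
          ∑ T ∈ Finset.univ.powersetCard u.natDegree,
            C ((((∏ i ∈ S, ∏ i' ∈ Sᶜ, (a i - a i')) * ∏ j ∈ T, ∏ j' ∈ Tᶜ, (b j - b j')))⁻¹ *
              ((∏ j ∈ Tᶜ, u.eval (b j)) *
                ∏ i ∈ Sᶜ, (v.eval (a i) * ∏ j ∈ Tᶜ, (a i - b j)))) *
              ((∏ i ∈ S, (X - C (a i))) * ∏ j ∈ T, (X - C (b j))) := by
  -- The outer variable of `L[X][X]` is `t` and the inner one is `x`. The map `ψ` substitutes `X -
  -- t`, moving every root by `t`, and `ε` sets `t = 0`.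
  let φ : L →+* L[X][X] := C.comp C
  let ψ : L[X] →+* L[X][X][X] := (compRingHom (X - C X)).comp (mapRingHom φ)
  let ε : L[X][X] →+* L[X] := evalRingHom 0
  have hφε : ∀ x, ε (φ x) = C x := fun x => by simp [ε, φ]
  have hεφ : ε.comp φ = C := RingHom.ext hφε
  have hεX : ε X = 0 := eval_X
  have hεC : ∀ x, ε (C x) = x := fun x => eval_C
  have hev : ∀ (Q : L[X][X][X]) y, ε (Q.eval y) = (Q.map ε).eval (ε y) :=
    fun Q y => (eval_map_apply ε y).symm
  have hψm : ∀ P : L[X], P.Monic → (ψ P).Monic := fun P hP =>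
    (hP.map φ).comp (monic_X_sub_C _) (by simp)
  have hψd : ∀ P : L[X], (ψ P).natDegree = P.natDegree := fun P => by
    change ((P.map φ).comp (X - C X)).natDegree = _
    rw [natDegree_comp, natDegree_X_sub_C, mul_one, natDegree_map]
  have hψX : ∀ x, ψ (X - C x) = X - C (φ x + X) := fun x => by
    simp [ψ]
    ring
  have hψeval : ∀ (P : L[X]) x, ε ((ψ P).eval (φ x)) = C (P.eval x) := fun P x => by
    change ε (((P.map φ).comp (X - C X)).eval (φ x)) = _
    rw [hev, map_comp, Polynomial.map_map, hεφ, hφε]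
    simp [ε, eval_map_apply]
  have hψε : ∀ P : L[X], (ψ P).map ε = P.map C := fun P => by
    change ((P.map φ).comp (X - C X)).map ε = _
    rw [map_comp, Polynomial.map_map, hεφ]
    simp [ε]
  have key := eval_sres_eq_sum (d := d) (fun i => φ (a i)) (fun j => φ (b j) + X)
    (f := f.map φ) (g := ψ g) (u := u.map φ) (v := ψ v)
    (fun i i' h => ha (φ.injective h)) (fun j j' h => hb (φ.injective (add_right_cancel h)))
    (fun i j h => by
      have := congrArg (fun P => coeff P 1) h
      simp [φ] at this)
    (C X) (hu.map φ) (hψm v hv) (by simp [hf, Polynomial.map_prod])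
    (by rw [hg, map_mul, map_prod]; simp only [hψX])
    (by rwa [natDegree_map, hψd]) (by rwa [natDegree_map]) (by rwa [hψd])
    (by rwa [natDegree_map, hψd])
    -- The shift leaves differences within `b` unchanged, so the denominators remain invertible
    -- constants.
    (fun S T => φ (((∏ i ∈ S, ∏ i' ∈ Sᶜ, (a i - a i')) * ∏ j ∈ T, ∏ j' ∈ Tᶜ, (b j - b j')))⁻¹)
    (fun S T => by
      simp only [add_sub_add_right_eq_sub, ← map_sub, ← map_prod, ← map_mul]
      rw [inv_mul_cancel₀, map_one]
      refine mul_ne_zero ?_ ?_ <;>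
      · refine Finset.prod_ne_zero_iff.2 fun i hi => Finset.prod_ne_zero_iff.2 fun i' hi' => ?_
        rw [sub_ne_zero]
        intro h
        first | have := ha h | have := hb h
        subst this
        simp_all)
  have hl : ε ((sres d (f.map φ) (ψ g)).eval (C X)) = sres d f g := by
    rw [hev, hεC, map_sres ε, hψε, Polynomial.map_map, hεφ, ← map_sres C]
    · simp [eval_map]
    · exact natDegree_map _
    · exact natDegree_map _
    · rw [Polynomial.map_map, hεφ, natDegree_map, natDegree_map]
    · rw [hψε, natDegree_map, hψd]
  rw [← hl, key]
  simp only [map_mul, map_pow, map_neg, map_one, map_sum, map_prod, map_sub, natDegree_map, hφε, ← hψeval]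
  simp only [hev, hψε, map_add, hεX, hφε, Polynomial.map_map, hεφ, hεC, add_zero, mul_assoc]

/-! ### Translation to multisets of roots -/

theorem rPoly_eq {R : Type*} [CommRing R] (Z : Multiset R) :
    rPoly Z = (Z.map fun z => X - C z).prod := by
  simp [rPoly, rProd]

theorem rProd_comm {R : Type*} [CommRing R] (Y Z : Multiset R) :
    rProd Y Z = (-1) ^ (Y.card * Z.card) * rProd Z Y := by
  have h : ∀ z, (Y.map fun y => y - z).prod = (-1) ^ Y.card * (Y.map fun y => z - y).prod := by
    intro z
    have : (Y.map fun y => y - z) = (Y.map fun y => z - y).map Neg.neg := by simp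
    rw [this, Multiset.prod_map_neg, Multiset.card_map]
  unfold rProd
  rw [Multiset.prod_map_prod_map]
  simp only [h, Multiset.prod_map_mul, Multiset.map_const', Multiset.prod_replicate, ← pow_mul]

theorem rProd_eq_prod_eval {R : Type*} [CommRing R] (S : Finset R) (Z : Multiset R) :
    rProd S.val Z = ∏ y ∈ S, (rPoly Z).eval y := by
  simp only [rProd, rPoly_eq, eval_multiset_prod, Multiset.map_map, Function.comp_def, eval_sub,
    eval_X, eval_C]
  rfl

theorem sres_eq_sylM_roots {L : Type*} [Field L] [DecidableEq L] {d : ℕ} {f g : L[X]} (hf : f.Monic)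
    (hg : g.Monic) (hfs : f.Splits) (hgs : g.Splits)
    (hd : excess f.roots + excess g.roots ≤ d) (hdf : d ≤ f.natDegree) (hdg : d ≤ g.natDegree)
    (hlt : 2 * d < f.natDegree + g.natDegree) :
    sres d f g = (-1) ^ (d * (f.natDegree - d)) * sylM d f.roots g.roots := by
  have hle : ∀ A : Multiset L, A.toFinset.val ≤ A := fun A => A.dedup_le
  have hcard : ∀ A : Multiset L, (A - A.toFinset.val).card = excess A := fun A => by
    rw [Multiset.card_sub (hle A)]; rfl
  have hmon : ∀ A : Multiset L, (rPoly A).Monic := fun A => by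
    rw [rPoly_eq]
    exact monic_multiset_prod_of_monic _ _ fun z _ => monic_X_sub_C z
  have hdeg : ∀ A : Multiset L, (rPoly A).natDegree = A.card := fun A => by
    rw [rPoly_eq, natDegree_multiset_prod_X_sub_C_eq_card]
  have hdeg' : ∀ A : Multiset L, (rPoly (A - A.toFinset.val)).natDegree = excess A := fun A => by
    rw [hdeg, hcard]
  have hadd : ∀ Y Z : Multiset L, rPoly (Y + Z) = rPoly Y * rPoly Z := fun Y Z => by
    simp [rPoly_eq]
  have hfact : ∀ A : Multiset L, rPoly A =
      rPoly (A - A.toFinset.val) * ∏ x : {x // x ∈ A.toFinset}, (X - C (x : L)) := fun A => by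
    conv_lhs => rw [← tsub_add_cancel_of_le (hle A), hadd]
    congr 1
    rw [rPoly_eq, Finset.prod_coe_sort A.toFinset fun x => X - C x]
    rfl
  have hrf : f = rPoly f.roots := by
    rw [rPoly_eq]; exact hfs.eq_prod_roots_of_monic hf
  have hrg : g = rPoly g.roots := by
    rw [rPoly_eq]; exact hgs.eq_prod_roots_of_monic hg
  have hfc : f.natDegree = f.roots.card := by
    conv_lhs => rw [hrf, hdeg]
  rw [sres_eq_sum (d := d) (fun x : {x // x ∈ f.roots.toFinset} => (x : L))
    (fun x : {x // x ∈ g.roots.toFinset} => (x : L)) Subtype.val_injective Subtype.val_injective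
    (hmon (f.roots - f.roots.toFinset.val)) (hmon (g.roots - g.roots.toFinset.val))
    (hrf.trans (hfact _)) (hrg.trans (hfact _)) (by rw [hdeg', hdeg']; exact hd) hdf hdg hlt]
  rw [hdeg', hfc] at *
  unfold sylM
  generalize f.roots = A at *
  generalize g.roots = B at *
  have hsub : ∀ (Y : Finset L) (k : ℕ), Y.powersetCard k =
      (Finset.univ.powersetCard k : Finset (Finset {x // x ∈ Y})).map
        (Finset.mapEmbedding (Function.Embedding.subtype _)).toEmbedding := fun Y k => by
    rw [← Finset.powersetCard_map]
    congr 1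
    ext
    simp
  rw [hsub, hsub]
  simp only [Finset.sum_map]
  have hcompl : ∀ (Y : Finset L) (S : Finset {x // x ∈ Y}),
      Y \ S.map (Function.Embedding.subtype _) = Sᶜ.map (Function.Embedding.subtype _) := by
    intro Y S
    ext x
    simp only [Finset.mem_sdiff, Finset.mem_map, Finset.mem_compl, Function.Embedding.subtype_apply,
      Subtype.exists, exists_and_right, exists_eq_right]
    exact ⟨fun h => ⟨h.1, fun h' => h.2 ⟨h.1, h'⟩⟩, fun ⟨h, h'⟩ => ⟨h, fun ⟨_, h''⟩ => h' h''⟩⟩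
  -- Modulo `2`, `d - m'` is `d + m'`, which yields the two signs of the statement. The remaining
  -- sign, inside `C`, is absorbed when `R(A \ A̅, B̅ \ B')` is reversed into values of `u` on `B̅ \
  -- B'`.
  have hsign : (-1 : L[X]) ^ ((A.card - d) * (d - excess A) +
      (Fintype.card B.toFinset - excess A) * excess A) = (-1) ^ (d * (A.card - d)) *
        ((-1) ^ (excess A * (A.card - d)) *
          C ((-1) ^ (excess A * (Fintype.card B.toFinset - excess A)))) := by
    obtain ⟨k, rfl⟩ : ∃ k, d = excess A + k := ⟨d - excess A, by omega⟩
    rw [map_pow, map_neg, map_one, ← mul_assoc, ← pow_add, pow_add, mul_comm (excess A) (_ - excess A)]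
    congr 1
    rw [Nat.add_sub_cancel_left, neg_one_pow_congr]
    rw [add_mul, add_right_comm, mul_comm (excess A), ← two_mul, Nat.even_add, mul_comm k]
    simp
  rw [hsign, mul_assoc, mul_assoc]
  congr 2
  simp only [Finset.mul_sum]
  refine Finset.sum_congr rfl fun S hS => Finset.sum_congr rfl fun T hT => ?_
  rw [Finset.mem_powersetCard] at hS hT
  change _ = C (rProd (A - A.toFinset.val)
      (B.toFinset \ T.map (Function.Embedding.subtype _)).val *
    rProd (A.toFinset \ S.map (Function.Embedding.subtype _)).val
      (B - (T.map (Function.Embedding.subtype _)).val) /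
    (rProd (S.map (Function.Embedding.subtype _)).val
      (A.toFinset \ S.map (Function.Embedding.subtype _)).val *
     rProd (T.map (Function.Embedding.subtype _)).val
      (B.toFinset \ T.map (Function.Embedding.subtype _)).val)) *
    rPoly (S.map (Function.Embedding.subtype _)).val *
    rPoly (T.map (Function.Embedding.subtype _)).val
  -- The first summand produces the values of `v`, the second the product over `Tᶜ`.
  have hB : B - (T.map (Function.Embedding.subtype _)).val = (B - B.toFinset.val) +
      (B.toFinset \ T.map (Function.Embedding.subtype _)).val := by
    rw [Finset.sdiff_val, tsub_add_tsub_cancel (hle B)]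
    refine Finset.val_le_iff.2 fun x hx => ?_
    obtain ⟨y, -, rfl⟩ := Finset.mem_map.1 hx
    exact y.2
  have hP : ∀ Y : Finset L, rPoly Y.val = ∏ y ∈ Y, (X - C y) := fun Y => rPoly_eq _
  rw [rProd_comm (A - _), hB, hcompl, hcompl]
  simp only [rProd_eq_prod_eval, hadd, eval_mul, hP, eval_prod, Finset.prod_map, hcard,
    Finset.card_val, Finset.card_map, Finset.card_compl, hT.2]
  simp only [Function.Embedding.subtype_apply, eval_sub, eval_X, eval_C, div_eq_mul_inv, C_mul]
  ring

end SubresultantMultipleRoots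

theorem theorem1p2 {K L : Type*} [Field K] [Field L] [Algebra K L] [DecidableEq L]
    (f g : K[X]) (hf : f.Monic) (hg : g.Monic)
    (hfs : (f.map (algebraMap K L)).Splits) (hgs : (g.map (algebraMap K L)).Splits)
    (m n : ℕ) (hm : f.natDegree = m) (hn : g.natDegree = n)
    (A B : Multiset L) (hA : A = f.aroots L) (hB : B = g.aroots L)
    (m' n' : ℕ) (hm' : m' = m - A.toFinset.card) (hn' : n' = n - B.toFinset.card)
    (d : ℕ) (hd : m' + n' ≤ d) (hdmin : d ≤ min m n) (hdlt : m = n → d < m) :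
    (SubresultantMultipleRoots.sres d f g).map (algebraMap K L) =
      (-1) ^ (d * (m - d)) * SubresultantMultipleRoots.sylM d A B := by
  have hf' : (f.map (algebraMap K L)).natDegree = m := by rw [natDegree_map, hm]
  have hg' : (g.map (algebraMap K L)).natDegree = n := by rw [natDegree_map, hn]
  have hAm : Multiset.card A = m := by
    rw [hA, ← hf']
    exact hfs.natDegree_eq_card_roots.symm
  have hBn : Multiset.card B = n := by
    rw [hB, ← hg']
    exact hgs.natDegree_eq_card_roots.symm
  have hA' : A = (f.map (algebraMap K L)).roots := hA
  have hB' : B = (g.map (algebraMap K L)).roots := hB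
  rw [SubresultantMultipleRoots.map_sres _ _ _ _ (natDegree_map _) (natDegree_map _),
    SubresultantMultipleRoots.sres_eq_sylM_roots (hf.map _) (hg.map _) hfs hgs, hf', ← hA', ← hB']
  · rw [← hA', ← hB', SubresultantMultipleRoots.excess, SubresultantMultipleRoots.excess, hAm,
      hBn]
    omega
  -- The strict bound `2 * d < m + n` combines `hdmin` and `hdlt`.
  all_goals omega
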